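/- For an odd integer $t\ge 3$ and $n \geq 0$, let $\overline{S}_t(n)$ denote the number of $t$-Schur overpartitions of $n$, that is, of overpartitions of $n$ (partitions of $n$ in which the first occurrence of each part size may be overlined) all of whose parts are congruent modulo $2t$ to an element of $I(t)=\{1,3,5,\dots,2t-1\}\setminus\{t\}$. Then, for all integers $\alpha\ge 0$ and $n\ge 0$, $$\overline{S}_9\left(3\cdot 4^{\alpha+2}\,n+10\cdot 4^{\alpha+1}\right)\equiv 0 \pmod 9.$$ -/

import Mathlib

/-- An overpartition of `n`: a partition of `n` in which the first occurrence of each part size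
may be overlined. The finset `overlined` records the part sizes whose first occurrence is
overlined. -/
@[ext]
structure Overpartition (n : ℕ) where
  /-- the underlying partition -/
  partition : n.Partition
  /-- the part sizes whose first occurrence is overlined -/
  overlined : Finset ℕ
  /-- only sizes which occur as parts can be overlined -/
  overlined_subset : overlined ⊆ partition.parts.toFinset

/-- There are only finitely many overpartitions of `n`, so that counting them with `Nat.card`
is meaningful. -/
instance Overpartition.instFinite (n : ℕ) : Finite (Overpartition n) := by
  let f : Overpartition n → Σ p : n.Partition, {s // s ∈ p.parts.toFinset.powerset} :=
    fun π => ⟨π.partition, π.overlined, Finset.mem_powerset.2 π.overlined_subset⟩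
  refine Finite.of_injective f ?_
  rintro ⟨p, s, hs⟩ ⟨p', s', hs'⟩ h
  simp only [f, Sigma.mk.injEq] at h
  obtain ⟨rfl, h⟩ := h
  simpa using h

/-- The set `I(t) = {1, 3, 5, …, 2t - 1} \ {t}` of admissible residues modulo `2t`. -/
def schurResidues (t : ℕ) : Finset ℕ :=
  ((Finset.range (2 * t)).filter Odd).erase t

/-- For odd `t ≥ 3`, a `t`-Schur overpartition is an overpartition all of whose parts are
congruent modulo `2t` to an element of `I(t)`. -/
def Overpartition.IsSchur (t : ℕ) {n : ℕ} (π : Overpartition n) : Prop :=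
  ∀ m ∈ π.partition.parts, ∃ i ∈ schurResidues t, m ≡ i [MOD 2 * t]

/-- The number of `t`-Schur overpartitions of `n` (for odd `t ≥ 3`). -/
noncomputable def schurOverpartitionCount (t n : ℕ) : ℕ :=
  Nat.card {π : Overpartition n // π.IsSchur t}

/-! Write φ(q) = ∑ q^(x²) = a + b, split into even and odd x, and c = φ(-q²). Since φ(q)/φ(-q²) = ∏
(1 + q^m)/(1 - q^m) over odd m, the generating function is S = φ(q) φ(-q^18) / (φ(-q²) φ(q^9))
(`schurSeries_mul_theta`).

Let a₉, b₉, c₉ be a, b, c at q^9, and a' = a - a₉, b' = b - b₉, D = c - c₉. Each has exponents in a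
single class modulo 6. Rationalising the denominator by a₉² - b₉² = c₉² and (c₉ + D)(c₉² - c₉D + D²)
= c₉³ + D³, the part of S with exponents 4 mod 6 is c₉(a'a₉ - b'b₉ + D²)/(c₉³ + D³). As D² = 2(a'a₉
- b'b₉), this equals 3K (`exists_section6_schurSeries`).

Modulo 3, q → q³ is cubing, so K becomes a polynomial in a, b and c² = a² - b². The relation a⁴ + b⁴
≡ 1, from the action of a cube root of unity on the form x² + 3y², reduces it to K ≡ a(q)a(q^27) +
b(q)b(q^27) - 1. The coefficients of the two products count representations by x² + 27y² with x ≡ y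
mod 2. There are none when the 2-adic valuation of the exponent is odd, which is the case in the
given progression. -/

open PowerSeries

/-! ### Binary and unary theta series as formal power series -/

/-- The lattice points representing `n` by the form `k x ^ 2 + l y ^ 2`. -/
noncomputable def repSet (k l n : ℕ) : Finset (ℤ × ℤ) :=
  (Finset.Icc (-(n : ℤ)) n ×ˢ Finset.Icc (-(n : ℤ)) n).filter
    fun p => (k : ℤ) * p.1 ^ 2 + l * p.2 ^ 2 = n

lemma mem_Icc_of_mul_sq_le {k n x : ℤ} (hk : 0 < k) (h : k * x ^ 2 ≤ n) : x ∈ Finset.Icc (-n) n := by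
  have h1 : x ^ 2 ≤ n := by nlinarith [sq_nonneg x]
  rw [Finset.mem_Icc]
  constructor <;> nlinarith [Int.le_self_sq x, Int.le_self_sq (-x)]

lemma mem_repSet {k l n : ℕ} (hk : 0 < k) (hl : 0 < l) {p : ℤ × ℤ} :
    p ∈ repSet k l n ↔ (k : ℤ) * p.1 ^ 2 + l * p.2 ^ 2 = n := by
  have hk' : (0 : ℤ) < k := by exact_mod_cast hk
  have hl' : (0 : ℤ) < l := by exact_mod_cast hl
  simp only [repSet, Finset.mem_filter, Finset.mem_product, and_iff_right_iff_imp]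
  intro h
  constructor
  · exact mem_Icc_of_mul_sq_le hk' (by nlinarith [sq_nonneg p.2])
  · exact mem_Icc_of_mul_sq_le hl' (by nlinarith [sq_nonneg p.1])

/-- The theta series `∑ w(x) q ^ (k x ^ 2)`, the sum being over all integers `x`. -/
noncomputable def theta (k : ℕ) (w : ℤ → ℤ) : ℤ⟦X⟧ :=
  PowerSeries.mk fun n => ∑ x ∈ Finset.Icc (-(n : ℤ)) n, if (k : ℤ) * x ^ 2 = n then w x else 0

/-- The theta series `∑ W(x, y) q ^ (k x ^ 2 + l y ^ 2)`, the sum being over all integers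
`x` and `y`. -/
noncomputable def theta₂ (k l : ℕ) (W : ℤ → ℤ → ℤ) : ℤ⟦X⟧ :=
  PowerSeries.mk fun n => ∑ p ∈ repSet k l n, W p.1 p.2

/-- Enlarging the summation range adds no solutions; this gives all terms of a Cauchy product one
common box. -/
lemma coeff_theta_of_le {k : ℕ} (hk : 0 < k) (w : ℤ → ℤ) {n m : ℕ} (h : n ≤ m) :
    coeff n (theta k w) =
      ∑ x ∈ Finset.Icc (-(m : ℤ)) m, if (k : ℤ) * x ^ 2 = n then w x else 0 := by
  rw [theta, coeff_mk]
  apply Finset.sum_subset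
  · apply Finset.Icc_subset_Icc <;> omega
  · intro x _ hx
    rw [if_neg]
    intro h
    exact hx (mem_Icc_of_mul_sq_le (by exact_mod_cast hk) h.le)

lemma theta_mul_theta {k l : ℕ} (hk : 0 < k) (hl : 0 < l) (w v : ℤ → ℤ) :
    theta k w * theta l v = theta₂ k l fun x y => w x * v y := by
  ext n
  rw [coeff_mul, theta₂, coeff_mk, repSet, Finset.sum_filter, Finset.sum_product]
  have : ∀ p ∈ Finset.HasAntidiagonal.antidiagonal n, coeff p.1 (theta k w) * coeff p.2 (theta l v) =
      ∑ x ∈ Finset.Icc (-(n : ℤ)) n, ∑ y ∈ Finset.Icc (-(n : ℤ)) n,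
        if (k : ℤ) * x ^ 2 = p.1 ∧ (l : ℤ) * y ^ 2 = p.2 then w x * v y else 0 := by
    intro p hp
    rw [coeff_theta_of_le hk w (Finset.HasAntidiagonal.antidiagonal.fst_le hp),
      coeff_theta_of_le hl v (Finset.HasAntidiagonal.antidiagonal.snd_le hp), Finset.sum_mul_sum]
    refine Finset.sum_congr rfl fun x _ => Finset.sum_congr rfl fun y _ => ?_
    split_ifs <;> simp_all
  rw [Finset.sum_congr rfl this, Finset.sum_comm]
  refine Finset.sum_congr rfl fun x _ => ?_
  rw [Finset.sum_comm]
  refine Finset.sum_congr rfl fun y _ => ?_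
  split_ifs with h
  · rw [Finset.sum_eq_single (k * x.natAbs ^ 2, l * y.natAbs ^ 2)]
    · simp
    · rintro ⟨i, j⟩ _ hne
      rw [if_neg]
      rintro ⟨h1, h2⟩
      apply hne
      rw [Prod.mk.injEq]
      constructor <;> zify <;> simp [h1, h2]
    · intro hn
      exfalso
      apply hn
      rw [Finset.HasAntidiagonal.mem_antidiagonal]
      zify
      simpa using h
  · refine Finset.sum_eq_zero fun p hp => if_neg ?_
    rintro ⟨h1, h2⟩
    rw [Finset.HasAntidiagonal.mem_antidiagonal] at hp
    apply h
    rw [h1, h2]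
    exact_mod_cast hp

lemma theta_add (k : ℕ) (w v : ℤ → ℤ) : theta k w + theta k v = theta k fun x => w x + v x := by
  ext n
  simp only [theta, map_add, coeff_mk, ← Finset.sum_add_distrib]
  refine Finset.sum_congr rfl fun x _ => ?_
  split_ifs <;> simp

lemma theta_sub (k : ℕ) (w v : ℤ → ℤ) : theta k w - theta k v = theta k fun x => w x - v x := by
  ext n
  simp only [theta, map_sub, coeff_mk, ← Finset.sum_sub_distrib]
  refine Finset.sum_congr rfl fun x _ => ?_
  split_ifs <;> simp

lemma theta₂_add (k l : ℕ) (W V : ℤ → ℤ → ℤ) :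
    theta₂ k l W + theta₂ k l V = theta₂ k l fun x y => W x y + V x y := by
  ext n
  simp only [theta₂, map_add, coeff_mk, Finset.sum_add_distrib]

lemma theta₂_sub (k l : ℕ) (W V : ℤ → ℤ → ℤ) :
    theta₂ k l W - theta₂ k l V = theta₂ k l fun x y => W x y - V x y := by
  ext n
  simp only [theta₂, map_sub, coeff_mk, Finset.sum_sub_distrib]

/-- Replacing `q` by `q ^ (m ^ 2)` amounts to summing over the multiples of `m`. -/
lemma theta_mul_sq {k m : ℕ} (hk : 0 < k) (hm : 0 < m) (w : ℤ → ℤ) :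
    theta (k * m ^ 2) w = theta k fun x => if (m : ℤ) ∣ x then w (x / m) else 0 := by
  have hm' : (0 : ℤ) < m := by exact_mod_cast hm
  have hk' : (0 : ℤ) < k := by exact_mod_cast hk
  ext n
  simp only [theta, coeff_mk, ← ite_and]
  rw [← Finset.sum_filter, ← Finset.sum_filter]
  refine Finset.sum_nbij' (fun x => m * x) (fun x => x / m) ?_ ?_ ?_ ?_ ?_
  · intro x hx
    rw [Finset.mem_filter] at hx ⊢
    have h : (k : ℤ) * (m * x) ^ 2 = n := by rw [← hx.2]; push_cast; ring
    exact ⟨mem_Icc_of_mul_sq_le hk' h.le, h, by simp⟩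
  · intro x hx
    rw [Finset.mem_filter] at hx ⊢
    obtain ⟨_, h, y, rfl⟩ := hx
    rw [Int.mul_ediv_cancel_left _ hm'.ne']
    have h : ((k * m ^ 2 : ℕ) : ℤ) * y ^ 2 = n := by rw [← h]; push_cast; ring
    exact ⟨mem_Icc_of_mul_sq_le (by positivity) h.le, h⟩
  · intro x _
    exact Int.mul_ediv_cancel_left _ hm'.ne'
  · intro x hx
    rw [Finset.mem_filter] at hx
    exact Int.mul_ediv_cancel' hx.2.2
  · intro x _
    rw [Int.mul_ediv_cancel_left _ hm'.ne']

lemma theta₂_swap {k : ℕ} (hk : 0 < k) (W : ℤ → ℤ → ℤ) :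
    theta₂ k k (fun x y => W y x) = theta₂ k k W := by
  ext n
  simp only [theta₂, coeff_mk]
  refine Finset.sum_nbij' Prod.swap Prod.swap ?_ ?_ ?_ ?_ ?_
  · intro p hp
    rw [mem_repSet hk hk] at hp ⊢
    simpa [add_comm] using hp
  · intro p hp
    rw [mem_repSet hk hk] at hp ⊢
    simpa [add_comm] using hp
  all_goals simp

/-- The rotation `(x, y) ↦ (x + y, x - y)` doubles the form `k x ^ 2 + k y ^ 2`. -/
lemma theta₂_rotate {k : ℕ} (hk : 0 < k) (W : ℤ → ℤ → ℤ) :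
    theta₂ (2 * k) (2 * k) W =
      theta₂ k k fun u v => if Even (u + v) then W ((u + v) / 2) ((u - v) / 2) else 0 := by
  have hk2 : 0 < 2 * k := by omega
  ext n
  simp only [theta₂, coeff_mk, ← Finset.sum_filter]
  refine Finset.sum_nbij' (fun p => (p.1 + p.2, p.1 - p.2))
    (fun p => ((p.1 + p.2) / 2, (p.1 - p.2) / 2)) ?_ ?_ ?_ ?_ ?_
  · rintro ⟨x, y⟩ hp
    rw [mem_repSet hk2 hk2] at hp
    rw [Finset.mem_filter, mem_repSet hk hk]
    refine ⟨?_, x, by ring⟩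
    rw [← hp]
    push_cast
    ring
  · rintro ⟨u, v⟩ hp
    rw [Finset.mem_filter, mem_repSet hk hk] at hp
    rw [mem_repSet hk2 hk2]
    obtain ⟨h, x, hx⟩ := hp
    dsimp only at h hx ⊢
    obtain rfl : u = 2 * x - v := by omega
    rw [show (2 * x - v + v) / 2 = x by omega, show (2 * x - v - v) / 2 = x - v by omega, ← h]
    push_cast
    ring
  · rintro ⟨x, y⟩ _
    simp only [Prod.mk.injEq]
    omega
  · rintro ⟨u, v⟩ hp
    rw [Finset.mem_filter] at hp
    obtain ⟨_, x, hx⟩ := hp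
    simp only [Prod.mk.injEq] at hx ⊢
    omega
  · rintro ⟨x, y⟩ _
    simp only
    rw [show (x + y + (x - y)) / 2 = x by omega, show (x + y - (x - y)) / 2 = y by omega]

/-! ### Parity weights -/

/-- The indicator of the even integers. -/
def evenWt (x : ℤ) : ℤ := if x % 2 = 0 then 1 else 0

/-- The indicator of the odd integers. -/
def oddWt (x : ℤ) : ℤ := if x % 2 = 0 then 0 else 1

/-- The sign `(-1) ^ x`. -/
def signWt (x : ℤ) : ℤ := if x % 2 = 0 then 1 else -1

/-- `φ(q) φ(-q) = φ(-q ^ 2) ^ 2`, with `φ(± q)` split into its even and odd parts. -/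
lemma theta_even_sq_sub_odd_sq {k : ℕ} (hk : 0 < k) :
    theta k evenWt ^ 2 - theta k oddWt ^ 2 = theta (2 * k) signWt ^ 2 := by
  rw [sq, sq, sq, theta_mul_theta hk hk, theta_mul_theta hk hk, theta_mul_theta (by omega) (by omega),
    theta₂_rotate hk, theta₂_sub]
  congr 1
  funext u v
  simp only [evenWt, oddWt, signWt, Int.even_iff]
  split_ifs <;> first | rfl | omega

/-- This is D² = 2(a'a₉ - b'b₉). Put u = x + y, v = x - y: neither x nor y is divisible by 3 exactly
when precisely one of u, v is, and (-1)^(x + y) is the common parity sign of u and v. The factor 2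
records which of u, v is the multiple of 3. -/
lemma sq_theta_sign_nonmultiple :
    theta 2 (fun x => signWt x - if (3 : ℤ) ∣ x then signWt (x / 3) else 0) ^ 2 =
      2 * (theta 1 (fun x => evenWt x - if (3 : ℤ) ∣ x then evenWt (x / 3) else 0) *
          theta 1 (fun x => if (3 : ℤ) ∣ x then evenWt (x / 3) else 0) -
        theta 1 (fun x => oddWt x - if (3 : ℤ) ∣ x then oddWt (x / 3) else 0) *
          theta 1 (fun x => if (3 : ℤ) ∣ x then oddWt (x / 3) else 0)) := by
  rw [sq, theta_mul_theta two_pos two_pos, theta_mul_theta one_pos one_pos,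
    theta_mul_theta one_pos one_pos, theta₂_sub, two_mul]
  -- One of the two equal copies is transposed, so that together they cover both positions of the
  -- multiple of 3.
  conv_rhs =>
    enter [1]
    rw [← theta₂_swap one_pos]
  rw [theta₂_add]
  change theta₂ (2 * 1) (2 * 1) _ = _
  rw [theta₂_rotate one_pos]
  congr 1
  funext u v
  -- For 3 ∣ x, the integers x / 3 and x have the same parity, so a weight of period 2 does not see
  -- the division.
  have hw (w : ℤ → ℤ) (hw : ∀ y, w y = w (y % 2)) (x : ℤ) :
      (if (3 : ℤ) ∣ x then w (x / 3) else 0) = w x * if x % 3 = 0 then 1 else 0 := by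
    by_cases h : (3 : ℤ) ∣ x
    · rw [if_pos h, if_pos (by omega), mul_one, hw, hw x]
      congr 1
      omega
    · rw [if_neg h, if_neg (by omega), mul_zero]
  simp only [hw evenWt (by simp [evenWt]), hw oddWt (by simp [oddWt]), hw signWt (by simp [signWt])]
  by_cases hp : Even (u + v)
  · rw [if_pos hp]
    obtain ⟨x, hx⟩ := hp
    obtain rfl : u = 2 * x - v := by omega
    rw [show (2 * x - v + v) / 2 = x by omega, show (2 * x - v - v) / 2 = x - v by omega]
    have h2 : evenWt (2 * x - v) * evenWt v - oddWt (2 * x - v) * oddWt v =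
        signWt x * signWt (x - v) := by
      simp only [evenWt, oddWt, signWt]
      split_ifs <;> first | rfl | omega
    have h3 : (1 - if x % 3 = 0 then 1 else 0) * (1 - if (x - v) % 3 = 0 then 1 else 0) =
        (1 - if (2 * x - v) % 3 = 0 then 1 else 0) * (if v % 3 = 0 then 1 else 0) +
        (1 - if v % 3 = 0 then 1 else 0) * (if (2 * x - v) % 3 = 0 then (1 : ℤ) else 0) := by
      have hx3 : x % 3 = 0 ∨ x % 3 = 1 ∨ x % 3 = 2 := by omega
      have hv3 : v % 3 = 0 ∨ v % 3 = 1 ∨ v % 3 = 2 := by omega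
      rcases hx3 with hx3 | hx3 | hx3 <;> rcases hv3 with hv3 | hv3 | hv3 <;> split_ifs <;> first | rfl | omega
    linear_combination signWt x * signWt (x - v) * h3 - h2 *
      ((1 - if (2 * x - v) % 3 = 0 then 1 else 0) * (if v % 3 = 0 then 1 else 0) +
        (1 - if v % 3 = 0 then 1 else 0) * (if (2 * x - v) % 3 = 0 then (1 : ℤ) else 0))
  · rw [if_neg hp]
    rw [Int.even_iff] at hp
    simp only [evenWt, oddWt]
    rcases Int.emod_two_eq_zero_or_one u with h | h <;>
    rcases Int.emod_two_eq_zero_or_one v with h' | h' <;> first | omega | simp [h, h']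

/-! ### Congruences modulo 3 -/

/-- Reduction modulo 3 of a formal power series. -/
noncomputable abbrev mod3 : ℤ⟦X⟧ →+* (ZMod 3)⟦X⟧ := PowerSeries.map (Int.castRingHom (ZMod 3))

/-- Frobenius is the identity on the coefficient ring `ZMod 3`, so cubing only replaces X by X³. -/
lemma pow_three_eq_expand (f : (ZMod 3)⟦X⟧) : f ^ 3 = PowerSeries.expand 3 three_ne_zero f := by
  have h : MvPowerSeries.map (frobenius (ZMod 3) 3) (MvPowerSeries.expand 3 three_ne_zero f) = f ^ 3 :=
    MvPowerSeries.map_frobenius_expand 3 three_ne_zero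
  rw [← h, ZMod.frobenius_zmod, MvPowerSeries.map_id]
  rfl

lemma mod3_theta_three_mul {k : ℕ} (hk : 0 < k) (w : ℤ → ℤ) :
    mod3 (theta (3 * k) w) = mod3 (theta k w) ^ 3 := by
  rw [pow_three_eq_expand]
  ext n
  rw [PowerSeries.coeff_expand, coeff_map, theta, coeff_mk]
  split_ifs with h
  · obtain ⟨m, rfl⟩ := h
    rw [Nat.mul_div_cancel_left _ three_pos, coeff_map,
      coeff_theta_of_le hk w (show m ≤ 3 * m by omega)]
    congr 1
    refine Finset.sum_congr rfl fun x _ => ?_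
    congr 1
    push_cast
    rw [mul_assoc]
    exact propext (mul_right_inj' three_ne_zero)
  · rw [Finset.sum_eq_zero, map_zero]
    intro x _
    rw [if_neg]
    intro hx
    apply h
    zify
    exact ⟨k * x ^ 2, by rw [← hx]; push_cast; ring⟩

/-- Multiplication by a primitive cube root of unity, in the coordinates `(x, y)` of
`x + y √-3`. -/
def rotateThree (p : ℤ × ℤ) : ℤ × ℤ := ((-p.1 - 3 * p.2) / 2, (p.1 - p.2) / 2)

/-- Pairs of equal parity are the elements x + y√-3 of twice the ring of Eisenstein integers.
Multiplication by a primitive cube root of unity preserves the norm and fixes only 0, so all orbits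
have size 3 when n ≠ 0. -/
lemma three_dvd_card_repSet_one_three {n : ℕ} (hn : n ≠ 0) :
    3 ∣ ((repSet 1 3 n).filter fun p => Even (p.1 + p.2)).card := by
  set T := (repSet 1 3 n).filter fun p => Even (p.1 + p.2) with hT
  have hmem : ∀ p, p ∈ T ↔ p.1 ^ 2 + 3 * p.2 ^ 2 = n ∧ Even (p.1 + p.2) := by
    intro p
    rw [hT, Finset.mem_filter, mem_repSet one_pos three_pos]
    simp
  have key : ∀ p ∈ T, ∃ a b : ℤ, p = (2 * a - b, b) ∧ rotateThree p = (-a - b, a - b) := by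
    rintro ⟨x, y⟩ hp
    obtain ⟨_, a, ha⟩ := (hmem _).1 hp
    dsimp only at ha
    refine ⟨a, y, ?_, ?_⟩ <;> simp only [rotateThree, Prod.mk.injEq, and_true] <;> omega
  have hmaps : ∀ p ∈ T, rotateThree p ∈ T := by
    intro p hp
    obtain ⟨a, b, rfl, h⟩ := key p hp
    rw [h]
    rw [hmem] at hp ⊢
    refine ⟨?_, -b, by ring⟩
    rw [← hp.1]
    ring
  let f : Function.End T := fun p => ⟨rotateThree p, hmaps p p.2⟩
  have hf : f ^ 3 ^ 1 = 1 := by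
    funext ⟨p, hp⟩
    apply Subtype.ext
    change rotateThree (rotateThree (rotateThree p)) = p
    obtain ⟨a, b, rfl, h⟩ := key p hp
    rw [h]
    simp only [rotateThree, Prod.mk.injEq]
    omega
  classical
  have hcard := Equiv.Perm.card_fixedPoints_modEq hf
  have hempty : IsEmpty f.fixedPoints := by
    refine ⟨fun ⟨⟨p, hp⟩, hfix⟩ => ?_⟩
    have hfix' : rotateThree p = p := congrArg Subtype.val hfix
    obtain ⟨a, b, rfl, h⟩ := key p hp
    rw [h] at hfix'
    simp only [Prod.mk.injEq] at hfix'
    have ha : a = 0 := by omega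
    have hb : b = 0 := by omega
    have := ((hmem _).1 hp).1
    apply hn
    simpa [ha, hb] using this.symm
  rw [Fintype.card_coe, Fintype.card_eq_zero] at hcard
  exact (Nat.modEq_zero_iff_dvd).1 hcard

lemma coeff_theta_even_mul_add_odd_mul (l n : ℕ) (hl : 0 < l) :
    coeff n (theta 1 evenWt * theta l evenWt + theta 1 oddWt * theta l oddWt) =
      ((repSet 1 l n).filter fun p => Even (p.1 + p.2)).card := by
  rw [theta_mul_theta one_pos hl, theta_mul_theta one_pos hl, theta₂_add, theta₂, coeff_mk,
    Finset.card_filter]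
  push_cast
  refine Finset.sum_congr rfl fun p _ => ?_
  simp only [evenWt, oddWt, Int.even_iff]
  split_ifs <;> first | rfl | omega

lemma repSet_zero {k l : ℕ} (hk : 0 < k) (hl : 0 < l) : repSet k l 0 = {(0, 0)} := by
  ext ⟨x, y⟩
  have hk' : (0 : ℤ) < k := by exact_mod_cast hk
  have hl' : (0 : ℤ) < l := by exact_mod_cast hl
  rw [mem_repSet hk hl, Finset.mem_singleton, Prod.mk.injEq]
  constructor
  · intro h
    dsimp only at h
    have hx := mul_nonneg hk'.le (sq_nonneg x)
    have hy := mul_nonneg hl'.le (sq_nonneg y)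
    have hx0 : (k : ℤ) * x ^ 2 = 0 := by push_cast at h; linarith
    have hy0 : (l : ℤ) * y ^ 2 = 0 := by push_cast at h; linarith
    simpa [hk.ne', hl.ne'] using And.intro hx0 hy0
  · rintro ⟨rfl, rfl⟩
    simp

/-- Modulo 3 the left side is a(q)a(q³) + b(q)b(q³), whose coefficients count the equal-parity
representations by x² + 3y²; only the constant term survives. -/
lemma mod3_theta_even_pow_four_add_odd_pow_four :
    mod3 (theta 1 evenWt) ^ 4 + mod3 (theta 1 oddWt) ^ 4 = 1 := by
  have h : mod3 (theta 1 evenWt * theta 3 evenWt + theta 1 oddWt * theta 3 oddWt) = 1 := by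
    ext n
    rw [coeff_map, coeff_theta_even_mul_add_odd_mul 3 n three_pos, coeff_one]
    split_ifs with hn
    · subst hn
      rw [repSet_zero one_pos three_pos]
      rfl
    · rw [eq_intCast, Int.cast_natCast, ZMod.natCast_eq_zero_iff]
      exact three_dvd_card_repSet_one_three hn
  have h3 := mod3_theta_three_mul one_pos
  rw [mul_one] at h3
  rw [← h, map_add, map_mul, map_mul, h3, h3]
  ring

/-- An integer whose `2`-adic valuation is odd is not of the form `x ^ 2 + 3 z ^ 2`. -/
lemma sq_add_three_mul_sq_ne (k : ℕ) (m x z : ℤ) :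
    x ^ 2 + 3 * z ^ 2 ≠ 4 ^ k * (2 * (2 * m + 1)) := by
  induction k generalizing x z with
  | zero =>
    intro h
    rcases Int.even_or_odd' x with ⟨a, rfl | rfl⟩ <;> rcases Int.even_or_odd' z with ⟨b, rfl | rfl⟩ <;>
      ring_nf at h <;> omega
  | succ k ih =>
    intro h
    rw [pow_succ (4 : ℤ)] at h
    rcases Int.even_or_odd' x with ⟨a, rfl | rfl⟩ <;> rcases Int.even_or_odd' z with ⟨b, rfl | rfl⟩
    · apply ih a b
      linarith
    · have : (4 : ℤ) ^ k * 4 * (2 * (2 * m + 1)) = 4 * (4 ^ k * (2 * (2 * m + 1))) := by ring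
      rw [this] at h
      ring_nf at h
      omega
    · have : (4 : ℤ) ^ k * 4 * (2 * (2 * m + 1)) = 4 * (4 ^ k * (2 * (2 * m + 1))) := by ring
      rw [this] at h
      ring_nf at h
      omega
    -- For x and z both odd the form is 4 mod 8, while the right side is divisible by 8.
    · obtain ⟨a', ha⟩ := Int.even_mul_succ_self a
      obtain ⟨b', hb⟩ := Int.even_mul_succ_self b
      have h8 : (4 : ℤ) ^ k * 4 * (2 * (2 * m + 1)) = 8 * (4 ^ k * (2 * m + 1)) := by ring
      rw [h8] at h
      have : (2 * a + 1) ^ 2 + 3 * (2 * b + 1) ^ 2 = 4 * (a * (a + 1)) + 12 * (b * (b + 1)) + 4 := by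
        ring
      rw [this, ha, hb] at h
      omega

lemma coeff_theta_one_twentySeven_eq_zero (k m : ℕ) :
    coeff (4 ^ k * (2 * (2 * m + 1)))
      (theta 1 evenWt * theta 27 evenWt + theta 1 oddWt * theta 27 oddWt) = 0 := by
  rw [coeff_theta_even_mul_add_odd_mul 27 _ (by norm_num), Int.natCast_eq_zero, Finset.card_eq_zero,
    Finset.filter_eq_empty_iff]
  intro p hp
  rw [mem_repSet one_pos (by norm_num)] at hp
  exfalso
  apply sq_add_three_mul_sq_ne k m p.1 (3 * p.2)
  push_cast at hp
  linarith

/-! ### Supports of power series modulo 6 -/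

/-- All exponents occurring in `f` are congruent to `r` modulo 6. -/
def SupportedMod6 (r : ZMod 6) (f : ℤ⟦X⟧) : Prop := ∀ n : ℕ, coeff n f ≠ 0 → (n : ZMod 6) = r

lemma SupportedMod6.mul {r s : ZMod 6} {f g : ℤ⟦X⟧} (hf : SupportedMod6 r f)
    (hg : SupportedMod6 s g) : SupportedMod6 (r + s) (f * g) := by
  intro n hn
  rw [coeff_mul] at hn
  obtain ⟨p, hp, hne⟩ := Finset.exists_ne_zero_of_sum_ne_zero hn
  rw [← hf p.1 (left_ne_zero_of_mul hne), ← hg p.2 (right_ne_zero_of_mul hne),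
    ← Finset.HasAntidiagonal.mem_antidiagonal.1 hp]
  push_cast
  rfl

lemma supportedMod6_theta {r : ZMod 6} {k : ℕ} {w : ℤ → ℤ}
    (h : ∀ x : ℤ, w x ≠ 0 → (k : ZMod 6) * (x : ZMod 6) ^ 2 = r) :
    SupportedMod6 r (theta k w) := by
  intro n hn
  rw [theta, coeff_mk] at hn
  obtain ⟨x, _, hne⟩ := Finset.exists_ne_zero_of_sum_ne_zero hn
  have h1 : (k : ℤ) * x ^ 2 = n := by
    by_contra h1
    exact hne (if_neg h1)
  rw [if_pos h1] at hne
  rw [← h x hne]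
  have := congrArg (Int.cast : ℤ → ZMod 6) h1
  push_cast at this
  exact this.symm

/-- The part of a power series whose exponents are congruent to `r` modulo 6. -/
noncomputable def section6 (r : ZMod 6) : ℤ⟦X⟧ →+ ℤ⟦X⟧ where
  toFun f := PowerSeries.mk fun n => if (n : ZMod 6) = r then coeff n f else 0
  map_zero' := by ext; simp
  map_add' f g := by
    ext n
    simp only [coeff_mk, map_add]
    split_ifs <;> simp

lemma coeff_section6 (r : ZMod 6) (f : ℤ⟦X⟧) (n : ℕ) :
    coeff n (section6 r f) = if (n : ZMod 6) = r then coeff n f else 0 := by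
  simp [section6]

lemma SupportedMod6.section6_eq {r s : ZMod 6} {f : ℤ⟦X⟧} (hf : SupportedMod6 s f) :
    section6 r f = if s = r then f else 0 := by
  ext n
  rw [coeff_section6]
  have := hf n
  split_ifs <;> grind

/-- This lets a denominator that is a series in q^6 pass through the extraction of a residue class.
-/
lemma section6_mul {r : ZMod 6} (f : ℤ⟦X⟧) {g : ℤ⟦X⟧} (hg : SupportedMod6 0 g) :
    section6 r (f * g) = section6 r f * g := by
  ext n
  have hite : coeff n (section6 r (f * g)) = ∑ p ∈ Finset.HasAntidiagonal.antidiagonal n,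
      if (n : ZMod 6) = r then coeff p.1 f * coeff p.2 g else 0 := by
    rw [coeff_section6, coeff_mul]
    split_ifs <;> simp
  rw [hite, coeff_mul]
  refine Finset.sum_congr rfl fun p hp => ?_
  rw [coeff_section6]
  by_cases h : coeff p.2 g = 0
  · simp [h]
  · have h0 := hg _ h
    rw [← Finset.HasAntidiagonal.mem_antidiagonal.1 hp]
    push_cast
    rw [h0, add_zero]
    split_ifs <;> simp

/-! ### The square of Gauss' product for `φ(± q)` -/

/-- The coefficient of `z ^ j` (equally of `z ^ (-j)`) in the product of
`(1 + z q ^ (2 k + 1)) (1 + z⁻¹ q ^ (2 k + 1))` over `k < n`. -/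
def tripleCoeff {R : Type*} [CommRing R] (q : R) : ℕ → ℕ → R
  | 0, 0 => 1
  | 0, _ + 1 => 0
  | n + 1, 0 => (1 + q ^ (4 * n + 2)) * tripleCoeff q n 0 + 2 * q ^ (2 * n + 1) * tripleCoeff q n 1
  | n + 1, j + 1 => (1 + q ^ (4 * n + 2)) * tripleCoeff q n (j + 1) +
      q ^ (2 * n + 1) * (tripleCoeff q n j + tripleCoeff q n (j + 2))

section TripleProduct

variable {R : Type*} [CommRing R] (q : R)

lemma tripleCoeff_eq_zero {n j : ℕ} (h : n < j) : tripleCoeff q n j = 0 := by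
  induction n generalizing j with
  | zero =>
    obtain ⟨j, rfl⟩ := Nat.exists_eq_add_one_of_ne_zero h.ne'
    rfl
  | succ n ih =>
    obtain ⟨j, rfl⟩ := Nat.exists_eq_add_one_of_ne_zero (Nat.ne_zero_of_lt h)
    rw [tripleCoeff, ih (by omega), ih (by omega), ih (by omega)]
    ring

/-- This is the comparison of coefficients in the functional equation of the finite triple product
under z → q²z, obtained here by induction from the recursion. -/
lemma tripleCoeff_succ_mul (n j : ℕ) :
    tripleCoeff q n (j + 1) * (1 - q ^ (2 * n + 2 * j + 2)) =
      (q ^ (2 * j + 1) - q ^ (2 * n + 1)) * tripleCoeff q n j := by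
  induction n generalizing j with
  | zero =>
    cases j with
    | zero => simp [tripleCoeff]
    | succ j => simp [tripleCoeff]
  | succ n ih =>
    cases j with
    | zero =>
      have h0 := ih 0
      have h1 := ih 1
      simp only [tripleCoeff, zero_add, Nat.reduceAdd] at h0 h1 ⊢
      linear_combination (1 + q ^ (4 * n + 4) - q ^ (2 * n + 2)) * h0 + q ^ (2 * n + 1) * h1
    | succ j =>
      have h0 := ih j
      have h1 := ih (j + 1)
      have h2 := ih (j + 2)
      simp only [tripleCoeff, add_assoc, Nat.reduceAdd] at h0 h1 h2 ⊢
      linear_combination q ^ (2 * n + 3) * h0 + (1 + q ^ (4 * n + 4)) * h1 + q ^ (2 * n + 1) * h2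

/-- To the precision q^(2n + 1), the previous recurrence says that each step from j to j + 1
multiplies by q^(2j + 1), and these odd exponents add up to j². -/
lemma pow_dvd_tripleCoeff_sub (n j : ℕ) :
    q ^ (2 * n + 1) ∣ tripleCoeff q n j - q ^ (j ^ 2) * tripleCoeff q n 0 := by
  induction j with
  | zero => simp
  | succ j ih =>
    obtain ⟨d, hd⟩ := ih
    have h := tripleCoeff_succ_mul q n j
    refine ⟨q ^ (2 * j + 1) * d - tripleCoeff q n j + q ^ (2 * j + 1) * tripleCoeff q n (j + 1), ?_⟩
    linear_combination h + q ^ (2 * j + 1) * hd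

/-- This is the finite triple product at z = ε: since ε⁻¹ = ε, its two families of factors coincide.
-/
lemma sum_tripleCoeff_eq_prod_sq {ε : R} (hε : ε ^ 2 = 1) (n : ℕ) :
    tripleCoeff q n 0 + 2 * ∑ j ∈ Finset.range n, ε ^ (j + 1) * tripleCoeff q n (j + 1) =
      (∏ k ∈ Finset.range n, (1 + ε * q ^ (2 * k + 1))) ^ 2 := by
  have hS (n N : ℕ) (hN : n ≤ N) : ∑ j ∈ Finset.range N, ε ^ (j + 1) * tripleCoeff q n (j + 1) =
      ∑ j ∈ Finset.range n, ε ^ (j + 1) * tripleCoeff q n (j + 1) := by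
    symm
    apply Finset.sum_subset (by simpa using hN)
    intro j _ hj
    rw [Finset.mem_range, not_lt] at hj
    rw [tripleCoeff_eq_zero q (by omega), mul_zero]
  induction n with
  | zero => simp [tripleCoeff]
  | succ n ih =>
    have h1 := hS n (n + 1) (by omega)
    have h2 : ∑ j ∈ Finset.range (n + 1), ε ^ (j + 1) * tripleCoeff q n j =
        ε * (∑ j ∈ Finset.range n, ε ^ (j + 1) * tripleCoeff q n (j + 1)) +
          ε * tripleCoeff q n 0 := by
      rw [Finset.sum_range_succ', Finset.mul_sum, zero_add, pow_one]
      congr 1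
      refine Finset.sum_congr rfl fun j _ => ?_
      ring
    have h3 : ε * ∑ j ∈ Finset.range (n + 1), ε ^ (j + 1) * tripleCoeff q n (j + 2) +
        ε * tripleCoeff q n 1 = ∑ j ∈ Finset.range n, ε ^ (j + 1) * tripleCoeff q n (j + 1) := by
      rw [← hS n (n + 2) (by omega), Finset.sum_range_succ' _ (n + 1), Finset.mul_sum, zero_add,
        pow_one]
      congr 1
      refine Finset.sum_congr rfl fun j _ => ?_
      ring
    have hsum : ∑ j ∈ Finset.range (n + 1), ε ^ (j + 1) * tripleCoeff q (n + 1) (j + 1) =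
        (1 + q ^ (4 * n + 2)) *
            (∑ j ∈ Finset.range (n + 1), ε ^ (j + 1) * tripleCoeff q n (j + 1)) +
          q ^ (2 * n + 1) * ((∑ j ∈ Finset.range (n + 1), ε ^ (j + 1) * tripleCoeff q n j) +
            ∑ j ∈ Finset.range (n + 1), ε ^ (j + 1) * tripleCoeff q n (j + 2)) := by
      rw [← Finset.sum_add_distrib, Finset.mul_sum, Finset.mul_sum, ← Finset.sum_add_distrib]
      refine Finset.sum_congr rfl fun j _ => ?_
      rw [tripleCoeff]
      ring
    rw [hsum, h1, h2, Finset.prod_range_succ, mul_pow, ← ih, tripleCoeff]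
    set G := ∑ j ∈ Finset.range n, ε ^ (j + 1) * tripleCoeff q n (j + 1)
    set T := ∑ j ∈ Finset.range (n + 1), ε ^ (j + 1) * tripleCoeff q n (j + 2)
    linear_combination 2 * q ^ (2 * n + 1) * ε * h3 - (q ^ (4 * n + 2) * (tripleCoeff q n 0 + 2 * G)
      + 2 * q ^ (2 * n + 1) * (T + tripleCoeff q n 1)) * hε

lemma pow_dvd_prod_sq_sub {ε : R} (hε : ε ^ 2 = 1) (n : ℕ) :
    q ^ (2 * n + 1) ∣ (∏ k ∈ Finset.range n, (1 + ε * q ^ (2 * k + 1))) ^ 2 -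
      tripleCoeff q n 0 * (1 + 2 * ∑ j ∈ Finset.range n, ε ^ (j + 1) * q ^ ((j + 1) ^ 2)) := by
  have h : (∏ k ∈ Finset.range n, (1 + ε * q ^ (2 * k + 1))) ^ 2 -
      tripleCoeff q n 0 * (1 + 2 * ∑ j ∈ Finset.range n, ε ^ (j + 1) * q ^ ((j + 1) ^ 2)) =
      2 * ∑ j ∈ Finset.range n, ε ^ (j + 1) *
        (tripleCoeff q n (j + 1) - q ^ ((j + 1) ^ 2) * tripleCoeff q n 0) := by
    simp only [← sum_tripleCoeff_eq_prod_sq q hε n, mul_sub, Finset.sum_sub_distrib]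
    rw [Finset.mul_sum, Finset.mul_sum, Finset.mul_sum, mul_add, Finset.mul_sum]
    have : ∀ j ∈ Finset.range n, tripleCoeff q n 0 * (2 * (ε ^ (j + 1) * q ^ ((j + 1) ^ 2))) =
      2 * (ε ^ (j + 1) * (q ^ ((j + 1) ^ 2) * tripleCoeff q n 0)) := fun j _ => by ring
    rw [Finset.sum_congr rfl this]
    ring
  rw [h]
  exact Dvd.dvd.mul_left (Finset.dvd_sum fun j _ => (pow_dvd_tripleCoeff_sub q n _).mul_left _) _

end TripleProduct

lemma sum_Icc_neg_eq {M : Type*} [AddCommMonoid M] (f : ℤ → M) (hf : ∀ x, f (-x) = f x) (n : ℕ) :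
    ∑ x ∈ Finset.Icc (-(n : ℤ)) n, f x = f 0 + 2 • ∑ j ∈ Finset.range n, f (j + 1) := by
  induction n with
  | zero => simp
  | succ n ih =>
    have h : Finset.Icc (-((n + 1 : ℕ) : ℤ)) (n + 1 : ℕ) =
        insert ((n : ℤ) + 1) (insert (-((n : ℤ) + 1)) (Finset.Icc (-(n : ℤ)) n)) := by
      ext x
      simp only [Finset.mem_Icc, Finset.mem_insert]
      omega
    rw [h, Finset.sum_insert (by simp; omega), Finset.sum_insert (by simp), ih, hf,
      Finset.sum_range_succ, smul_add, two_nsmul (f _)]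
    abel

lemma X_pow_dvd_theta_sub {r : ℕ} (hr : 0 < r) {w : ℤ → ℤ} (hw : ∀ x, w (-x) = w x) (n : ℕ) :
    (X : ℤ⟦X⟧) ^ (n + 1) ∣ theta r w -
      (C (w 0) + 2 * ∑ j ∈ Finset.range n, C (w (j + 1)) * (X ^ r) ^ ((j + 1) ^ 2)) := by
  rw [X_pow_dvd_iff]
  intro m hm
  rw [map_sub, sub_eq_zero, coeff_theta_of_le hr w (show m ≤ n by omega),
    sum_Icc_neg_eq _ (fun x => by rw [neg_sq, hw]), map_add, two_mul, map_add, ← two_nsmul,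
    map_sum, coeff_C]
  congr 1
  · simp [eq_comm]
  · congr 1
    refine Finset.sum_congr rfl fun j _ => ?_
    rw [coeff_C_mul, ← pow_mul, coeff_X_pow, mul_ite, mul_one, mul_zero]
    congr 1
    rw [eq_comm (a := m)]
    norm_cast

/-! ### The infinite products -/

open scoped PowerSeries.WithPiTopology

open Filter Topology

/-- The product of `1 + ε q ^ (r (2 k + 1))` over all natural numbers `k`. -/
noncomputable def oddProd (r : ℕ) (ε : ℤ⟦X⟧) : ℤ⟦X⟧ := ∏' k : ℕ, (1 + ε * (X ^ r) ^ (2 * k + 1))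

lemma hasProd_oddProd {r : ℕ} (hr : 0 < r) (ε : ℤ⟦X⟧) :
    HasProd (fun k : ℕ => 1 + ε * (X ^ r) ^ (2 * k + 1)) (oddProd r ε) := by
  refine Multipliable.hasProd ?_
  apply WithPiTopology.multipliable_one_add_of_tendsto_order_atTop_nhds_top
  refine ENat.tendsto_nhds_top_iff_natCast_lt.mpr fun n => Filter.eventually_atTop.mpr ⟨n, ?_⟩
  intro k hk
  refine lt_of_lt_of_le ?_ (le_order_mul _ _)
  rw [← pow_mul, order_X_pow]
  refine lt_of_lt_of_le ?_ (le_add_self)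
  norm_cast
  nlinarith

lemma tendsto_oddProd {r : ℕ} (hr : 0 < r) (ε : ℤ⟦X⟧) :
    Tendsto (fun n => ∏ k ∈ Finset.range n, (1 + ε * (X ^ r) ^ (2 * k + 1))) atTop
      (𝓝 (oddProd r ε)) :=
  (hasProd_oddProd hr ε).tendsto_prod_nat

lemma constantCoeff_oddProd {r : ℕ} (hr : 0 < r) (ε : ℤ⟦X⟧) : constantCoeff (oddProd r ε) = 1 := by
  have h := ((WithPiTopology.continuous_constantCoeff ℤ).tendsto _).comp (tendsto_oddProd hr ε)
  refine tendsto_nhds_unique h ?_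
  have : constantCoeff ∘ (fun n => ∏ k ∈ Finset.range n, (1 + ε * ((X : ℤ⟦X⟧) ^ r) ^ (2 * k + 1))) =
      fun _ => 1 := by
    funext n
    simp [hr.ne']
  rw [this]
  exact tendsto_const_nhds

lemma eq_of_tendsto_of_X_pow_dvd {f : ℕ → ℤ⟦X⟧} {g : ℤ⟦X⟧} (h : Tendsto f atTop (𝓝 g))
    (hf : ∀ n, (X : ℤ⟦X⟧) ^ (n + 1) ∣ f n) : g = 0 := by
  refine tendsto_nhds_unique h ?_
  rw [WithPiTopology.tendsto_iff_coeff_tendsto]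
  intro d
  refine tendsto_atTop_of_eventually_const (i₀ := d) fun n hn => ?_
  rw [X_pow_dvd_iff.1 (hf n) d (by omega), map_zero]

lemma constantCoeff_theta {r : ℕ} (w : ℤ → ℤ) : constantCoeff (theta r w) = w 0 := by
  rw [← coeff_zero_eq_constantCoeff_apply, theta, coeff_mk]
  simp

/-- For ε = ±1 the squared product is φ(εq) times the same central coefficient `tripleCoeff`.
Cross-multiplying eliminates that coefficient, so its limit never has to be evaluated. -/
lemma oddProd_sq_mul_theta {r : ℕ} (hr : 0 < r) :
    oddProd r 1 ^ 2 * theta r signWt = oddProd r (-1) ^ 2 * theta r (fun _ => 1) := by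
  have key (ε : ℤ⟦X⟧) (w : ℤ → ℤ) (hε : ε ^ 2 = 1) (hw : ∀ x, w (-x) = w x) (h0 : w 0 = 1)
      (hw' : ∀ j : ℕ, C (w (j + 1)) = ε ^ (j + 1)) (n : ℕ) :
      (X : ℤ⟦X⟧) ^ (n + 1) ∣ (∏ k ∈ Finset.range n, (1 + ε * (X ^ r) ^ (2 * k + 1))) ^ 2 -
        tripleCoeff (X ^ r) n 0 * theta r w := by
    have h1 := pow_dvd_prod_sq_sub ((X : ℤ⟦X⟧) ^ r) hε n
    have h2 := X_pow_dvd_theta_sub hr hw n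
    simp only [hw', h0, map_one] at h2
    rw [← pow_mul] at h1
    have h3 := (pow_dvd_pow (X : ℤ⟦X⟧) (show n + 1 ≤ r * (2 * n + 1) by nlinarith)).trans h1
    have h4 := dvd_sub h3 (h2.mul_left (tripleCoeff (X ^ r) n 0))
    convert h4 using 1
    ring
  have hp := key 1 (fun _ => 1) (by ring) (by simp) rfl (by simp)
  have hm := key (-1) signWt (by ring) (by simp [signWt]) rfl (by
    intro j
    rcases Nat.even_or_odd' j with ⟨i, rfl | rfl⟩
    · rw [signWt, if_neg (by omega), pow_succ, pow_mul]
      simp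
    · rw [signWt, if_pos (by omega), pow_succ, pow_succ, pow_mul]
      simp)
  rw [← sub_eq_zero]
  refine eq_of_tendsto_of_X_pow_dvd ((((tendsto_oddProd hr 1).pow 2).mul_const _).sub
    (((tendsto_oddProd hr (-1)).pow 2).mul_const _)) fun n => ?_
  have h := dvd_sub ((hp n).mul_right (theta r signWt)) ((hm n).mul_right (theta r fun _ => 1))
  convert h using 1
  ring

/-- The product formula for `φ(q) / φ(-q ^ 2)`, with `q ^ r` in place of `q`. -/
lemma oddProd_mul_theta {r : ℕ} (hr : 0 < r) :
    oddProd r 1 * theta (2 * r) signWt = oddProd r (-1) * (theta r evenWt + theta r oddWt) := by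
  have h1 : theta r evenWt + theta r oddWt = theta r (fun _ => 1) := by
    rw [theta_add]
    congr 1
    funext x
    simp only [evenWt, oddWt]
    split_ifs <;> rfl
  have h2 : theta r evenWt - theta r oddWt = theta r signWt := by
    rw [theta_sub]
    congr 1
    funext x
    simp only [evenWt, oddWt, signWt]
    split_ifs <;> rfl
  have h3 := theta_even_sq_sub_odd_sq hr
  have h4 := oddProd_sq_mul_theta hr
  rw [← h1, ← h2] at h4
  -- From φ(-q²)² = φ(q)φ(-q) only the squares are known to agree; comparing constant terms then
  -- excludes the minus sign.
  have h5 : (oddProd r 1 * theta (2 * r) signWt) ^ 2 =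
      (oddProd r (-1) * (theta r evenWt + theta r oddWt)) ^ 2 := by
    linear_combination (theta r evenWt + theta r oddWt) * h4 - oddProd r 1 ^ 2 * h3
  rcases sq_eq_sq_iff_eq_or_eq_neg.1 h5 with h | h
  · exact h
  · have := congrArg constantCoeff h
    simp [constantCoeff_oddProd hr, constantCoeff_theta, signWt, evenWt, oddWt] at this

lemma oddProd_ne_zero {r : ℕ} (hr : 0 < r) (ε : ℤ⟦X⟧) : oddProd r ε ≠ 0 := by
  intro h
  have := constantCoeff_oddProd hr ε
  simp [h] at this

open scoped Classical in
/-- The factors of `oddProd`, placed at the exponents of `q` which occur in them. -/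
lemma hasProd_oddProd_extend {r : ℕ} (hr : 0 < r) (ε : ℤ⟦X⟧) :
    HasProd (fun i : ℕ => if ∃ k, i + 1 = r * (2 * k + 1) then 1 + ε * X ^ (i + 1) else 1)
      (oddProd r ε) := by
  have hpos (k : ℕ) : r * (2 * k + 1) - 1 + 1 = r * (2 * k + 1) :=
    Nat.sub_add_cancel (Nat.mul_pos hr (by omega))
  have hinj : Function.Injective fun k : ℕ => r * (2 * k + 1) - 1 := by
    intro k l h
    have h' : r * (2 * k + 1) = r * (2 * l + 1) := by rw [← hpos k, ← hpos l]; exact congrArg _ h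
    have := Nat.eq_of_mul_eq_mul_left hr h'
    omega
  rw [← hinj.hasProd_iff]
  · convert hasProd_oddProd hr ε using 1
    funext k
    simp only [Function.comp_apply]
    rw [hpos, if_pos ⟨k, rfl⟩, pow_mul]
  · intro i hi
    rw [if_neg]
    rintro ⟨k, hk⟩
    exact hi ⟨k, by simp only; omega⟩

/-! ### The generating function of Schur overpartitions -/

/-- The admissible parts of a `t`-Schur overpartition. -/
def IsSchurPart (t m : ℕ) : Prop := ∃ i ∈ schurResidues t, m ≡ i [MOD 2 * t]

open scoped Classical in
/-- Schur overpartitions as pairs of a partition and a set of part sizes. -/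
noncomputable def schurOverpartitionEquiv (t n : ℕ) :
    {π : Overpartition n // π.IsSchur t} ≃
      Σ p : n.Partition, {s : Finset ℕ //
        s ∈ if ∀ m ∈ p.parts.toFinset, IsSchurPart t m then p.parts.toFinset.powerset else ∅} where
  toFun π := ⟨π.1.partition, π.1.overlined, by
    rw [if_pos (show ∀ m ∈ π.1.partition.parts.toFinset, IsSchurPart t m from
      fun m hm => π.2 m (Multiset.mem_toFinset.1 hm))]
    exact Finset.mem_powerset.2 π.1.overlined_subset⟩
  invFun x := ⟨⟨x.1, x.2.1, by
      have := x.2.2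
      split_ifs at this
      · exact Finset.mem_powerset.1 this
      · simp at this⟩, by
      have := x.2.2
      split_ifs at this with h
      · exact fun m hm => h m (Multiset.mem_toFinset.2 hm)
      · simp at this⟩
  left_inv _ := rfl
  right_inv _ := rfl

open scoped Classical in
-- An admissible partition carries one free choice, overlined or not, for each distinct part size,
-- whence the weight 2 per size whatever its multiplicity.
lemma schurOverpartitionCount_eq (t n : ℕ) :
    (schurOverpartitionCount t n : ℤ) =
      coeff n (Nat.Partition.genFun fun m _ => if IsSchurPart t m then (2 : ℤ) else 0) := by
  rw [schurOverpartitionCount, Nat.card_congr (schurOverpartitionEquiv t n), Nat.card_sigma,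
    Nat.Partition.coeff_genFun]
  push_cast
  refine Finset.sum_congr rfl fun p _ => ?_
  rw [Finsupp.prod, Multiset.toFinsupp_support, Finset.prod_ite_zero, Finset.prod_const,
    Nat.card_eq_fintype_card, Fintype.card_coe]
  split_ifs with h
  · simp [Finset.card_powerset]
  · simp

lemma isSchurPart_nine_iff (m : ℕ) : IsSchurPart 9 m ↔ Odd m ∧ ¬ 9 ∣ m := by
  simp only [IsSchurPart, schurResidues, Nat.ModEq, Finset.mem_erase, Finset.mem_filter,
    Finset.mem_range, Nat.odd_iff]
  constructor
  · rintro ⟨i, ⟨h1, h2, h3⟩, h⟩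
    omega
  · rintro ⟨h1, h2⟩
    exact ⟨m % 18, by omega, by omega⟩

/-- The generating function of the number of 9-Schur overpartitions. -/
noncomputable def schurSeries : ℤ⟦X⟧ := PowerSeries.mk fun n => (schurOverpartitionCount 9 n : ℤ)

open scoped Classical in
lemma hasProd_schurSeries :
    HasProd (fun i : ℕ => if IsSchurPart 9 (i + 1) then
      1 + 2 * ((X : ℤ⟦X⟧) ^ (i + 1) * ∑' j : ℕ, (X ^ (i + 1)) ^ j) else 1) schurSeries := by
  have h : schurSeries = Nat.Partition.genFun fun m _ => if IsSchurPart 9 m then (2 : ℤ) else 0 := by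
    ext n
    rw [schurSeries, coeff_mk, schurOverpartitionCount_eq]
  rw [h]
  convert! Nat.Partition.hasProd_genFun (fun m _ => if IsSchurPart 9 m then (2 : ℤ) else 0) using 1
  funext i
  split_ifs
  · have hs := WithPiTopology.summable_pow_of_constantCoeff_eq_zero
      (f := (X : ℤ⟦X⟧) ^ (i + 1)) (by simp)
    rw [← hs.tsum_mul_left, ← (hs.mul_left _).tsum_mul_left]
    congr 2
    funext j
    rw [PowerSeries.smul_eq_C_mul, pow_mul, map_ofNat]
    ring
  · simp [PowerSeries.smul_eq_C_mul]

/-- The factors agree exponent by exponent: for x = q^m with m odd and 9 ∤ m, (1 + 2x/(1 - x))(1 -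
x) = 1 + x; for odd multiples of 9 both sides carry (1 - x)(1 + x). -/
lemma schurSeries_mul_oddProd :
    schurSeries * oddProd 1 (-1) * oddProd 9 1 = oddProd 1 1 * oddProd 9 (-1) := by
  classical
  have h1 := (hasProd_schurSeries.mul (hasProd_oddProd_extend one_pos (-1))).mul
    (hasProd_oddProd_extend (r := 9) (by norm_num) 1)
  have h2 := (hasProd_oddProd_extend one_pos 1).mul
    (hasProd_oddProd_extend (r := 9) (by norm_num) (-1))
  refine h1.unique ?_
  convert h2 using 1
  funext i
  have hodd : (∃ k, i + 1 = 1 * (2 * k + 1)) ↔ Odd (i + 1) := by simp [Odd]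
  have hnine : (∃ k, i + 1 = 9 * (2 * k + 1)) ↔ Odd (i + 1) ∧ 9 ∣ i + 1 := by
    rw [Nat.odd_iff]
    constructor
    · rintro ⟨k, hk⟩
      omega
    · rintro ⟨_, m, hm⟩
      exact ⟨m / 2, by omega⟩
  simp only [hodd, hnine, isSchurPart_nine_iff]
  by_cases ho : Odd (i + 1)
  · by_cases hn : 9 ∣ i + 1
    · simp only [ho, hn, and_true, not_true, and_false, if_true, if_false]
      ring
    · have hg := WithPiTopology.tsum_pow_mul_one_sub_of_constantCoeff_eq_zero
        (f := (X : ℤ⟦X⟧) ^ (i + 1)) (by simp)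
      simp only [ho, hn, and_false, not_false_eq_true, and_true, if_true, if_false]
      linear_combination 2 * X ^ (i + 1) * hg
  · simp [ho]

lemma schurSeries_mul_theta :
    schurSeries * theta 2 signWt * (theta 9 evenWt + theta 9 oddWt) =
      (theta 1 evenWt + theta 1 oddWt) * theta 18 signWt := by
  have h := schurSeries_mul_oddProd
  have h1 := oddProd_mul_theta one_pos
  have h9 := oddProd_mul_theta (r := 9) (by norm_num)
  norm_num at h1 h9
  have hne := mul_ne_zero (oddProd_ne_zero one_pos (-1)) (oddProd_ne_zero (r := 9) (by norm_num) (-1))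
  apply mul_left_cancel₀ hne
  linear_combination theta 2 signWt * theta 18 signWt * h -
    schurSeries * oddProd 1 (-1) * theta 2 signWt * h9 + theta 18 signWt * oddProd 9 (-1) * h1

/-! ### The progression `4` modulo `6` -/

lemma theta_nine_mul {k : ℕ} (hk : 0 < k) (w : ℤ → ℤ) :
    theta (9 * k) w = theta k fun x => if (3 : ℤ) ∣ x then w (x / 3) else 0 := by
  rw [show 9 * k = k * 3 ^ 2 by ring, theta_mul_sq hk three_pos]
  rfl

lemma exists_section6_schurSeries :
    ∃ K : ℤ⟦X⟧, section6 4 schurSeries = 3 * K ∧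
      K * (theta 18 signWt ^ 3 + (theta 2 signWt - theta 18 signWt) ^ 3) =
        theta 18 signWt * ((theta 1 evenWt - theta 9 evenWt) * theta 9 evenWt -
          (theta 1 oddWt - theta 9 oddWt) * theta 9 oddWt) := by
  have hF := schurSeries_mul_theta
  have hc9 := theta_even_sq_sub_odd_sq (k := 9) (by norm_num)
  norm_num at hc9
  have hD : (theta 2 signWt - theta 18 signWt) ^ 2 =
      2 * ((theta 1 evenWt - theta 9 evenWt) * theta 9 evenWt -
          (theta 1 oddWt - theta 9 oddWt) * theta 9 oddWt) := by
    have := sq_theta_sign_nonmultiple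
    rwa [← theta_sub, ← theta_sub, ← theta_sub, ← theta_nine_mul one_pos, ← theta_nine_mul one_pos,
      ← theta_nine_mul two_pos] at this
  have h6 (x : ℤ) : ∃ y : ZMod 6, (x : ZMod 6) = y ∧ ((x % 2 = 0 → y = 0 ∨ y = 2 ∨ y = 4) ∧
      (x % 2 ≠ 0 → y = 1 ∨ y = 3 ∨ y = 5)) ∧ (¬ (3 : ℤ) ∣ x → y = 1 ∨ y = 2 ∨ y = 4 ∨ y = 5) := by
    refine ⟨_, rfl, ?_⟩
    rw [← Int.emod_add_mul_ediv x 6]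
    push_cast
    rw [show (6 : ZMod 6) = 0 from rfl, zero_mul, add_zero]
    have : x % 6 = 0 ∨ x % 6 = 1 ∨ x % 6 = 2 ∨ x % 6 = 3 ∨ x % 6 = 4 ∨ x % 6 = 5 := by omega
    rcases this with h | h | h | h | h | h <;> rw [h] <;> refine ⟨⟨?_, ?_⟩, ?_⟩ <;> intro h' <;>
      first | (exfalso; omega) | decide
  have hsa9 : SupportedMod6 0 (theta 9 evenWt) := supportedMod6_theta fun x hx => by
    obtain ⟨y, hy, ⟨he, -⟩, -⟩ := h6 x
    rw [hy]
    rcases he (by by_contra h; simp [evenWt, h] at hx) with rfl | rfl | rfl <;> rfl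
  have hsb9 : SupportedMod6 3 (theta 9 oddWt) := supportedMod6_theta fun x hx => by
    obtain ⟨y, hy, ⟨-, ho⟩, -⟩ := h6 x
    rw [hy]
    rcases ho (by by_contra h; simp [oddWt, h] at hx) with rfl | rfl | rfl <;> rfl
  have hsc9 : SupportedMod6 0 (theta 18 signWt) := supportedMod6_theta fun x _ => by
    rw [show ((18 : ℕ) : ZMod 6) = 0 from rfl, zero_mul]
  have hsa : SupportedMod6 4 (theta 1 evenWt - theta 9 evenWt) := by
    rw [show 9 = 9 * 1 from rfl, theta_nine_mul one_pos, theta_sub]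
    refine supportedMod6_theta fun x hx => ?_
    have he : x % 2 = 0 := by
      by_contra h
      apply hx
      simp only [evenWt]
      split_ifs <;> first | rfl | omega
    have h3 : ¬ (3 : ℤ) ∣ x := by
      intro h
      apply hx
      simp only [evenWt]
      split_ifs <;> first | rfl | omega
    obtain ⟨y, hy, ⟨he', -⟩, h3'⟩ := h6 x
    rw [hy]
    have e1 := he' he
    have e2 := h3' h3
    clear hy he' h3'
    revert y
    decide
  have hsb : SupportedMod6 1 (theta 1 oddWt - theta 9 oddWt) := by
    rw [show 9 = 9 * 1 from rfl, theta_nine_mul one_pos, theta_sub]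
    refine supportedMod6_theta fun x hx => ?_
    have ho : x % 2 ≠ 0 := by
      intro h
      apply hx
      simp only [oddWt]
      split_ifs <;> first | rfl | omega
    have h3 : ¬ (3 : ℤ) ∣ x := by
      intro h
      apply hx
      simp only [oddWt]
      split_ifs <;> first | rfl | omega
    obtain ⟨y, hy, ⟨-, ho'⟩, h3'⟩ := h6 x
    rw [hy]
    have e1 := ho' ho
    have e2 := h3' h3
    clear hy ho' h3'
    revert y
    decide
  have hsD : SupportedMod6 2 (theta 2 signWt - theta 18 signWt) := by
    rw [show 18 = 9 * 2 from rfl, theta_nine_mul two_pos, theta_sub]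
    refine supportedMod6_theta fun x hx => ?_
    have h3 : ¬ (3 : ℤ) ∣ x := by
      intro h
      apply hx
      simp only [signWt]
      split_ifs <;> first | rfl | omega
    obtain ⟨y, hy, -, h3'⟩ := h6 x
    rw [hy]
    rcases h3' h3 with rfl | rfl | rfl | rfl <;> rfl
  set a9 := theta 9 evenWt
  set b9 := theta 9 oddWt
  set c9 := theta 18 signWt
  set c := theta 2 signWt
  obtain ⟨a', ha⟩ : ∃ a', a' = theta 1 evenWt - a9 := ⟨_, rfl⟩
  obtain ⟨b', hb⟩ : ∃ b', b' = theta 1 oddWt - b9 := ⟨_, rfl⟩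
  obtain ⟨D, hDdef⟩ : ∃ D, D = c - c9 := ⟨_, rfl⟩
  rw [← ha] at hsa hD ⊢
  rw [← hb] at hsb hD ⊢
  rw [← hDdef] at hsD hD ⊢
  have hc9one : constantCoeff c9 = 1 := by rw [constantCoeff_theta]; rfl
  have hcone : constantCoeff c = 1 := by rw [constantCoeff_theta]; rfl
  have hc9ne : c9 ≠ 0 := by
    intro h
    simp [h] at hc9one
  -- The theta quotient is multiplied by (a9 - b9)(c9² - c9 D + D²) and one factor c9 is cancelled.
  -- The right side is expanded into monomials of degree four, each supported in one class modulo 6;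
  -- those in class 4 form the first bracket.
  have hexp : schurSeries * ((c9 * c9 * c9 + D * D * D) * c9) =
      (c9 * (c9 * (a' * a9)) - c9 * (c9 * (b' * b9)) + c9 * (c9 * (D * D))) +
      (c9 * (c9 * (c9 * c9)) - c9 * (c9 * (c9 * D)) + c9 * (c9 * (b' * a9)) - c9 * (c9 * (a' * b9))
        - c9 * (D * (a' * a9)) - c9 * (D * (b' * a9)) + c9 * (D * (a' * b9)) + c9 * (D * (b' * b9))
        + D * (D * (a' * a9)) + D * (D * (b' * a9)) - D * (D * (a' * b9)) - D * (D * (b' * b9))) := by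
    apply mul_left_cancel₀ hc9ne
    rw [show theta 1 evenWt = a' + a9 by rw [ha]; ring, show theta 1 oddWt = b' + b9 by rw [hb]; ring,
      show c = c9 + D by rw [hDdef]; ring] at hF
    linear_combination (a9 - b9) * (c9 ^ 2 - c9 * D + D ^ 2) * hF +
      (c9 * (c9 ^ 2 - c9 * D + D ^ 2) - schurSeries * (c9 ^ 3 + D ^ 3)) * hc9
  have hW : SupportedMod6 0 ((c9 * c9 * c9 + D * D * D) * c9) := by
    have h1 := ((hsc9.mul hsc9).mul hsc9).mul hsc9
    have h2 := ((hsD.mul hsD).mul hsD).mul hsc9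
    intro n hn
    rw [add_mul, map_add] at hn
    by_cases h : coeff n (c9 * c9 * c9 * c9) = 0
    · rw [h, zero_add] at hn
      exact h2 n hn
    · exact h1 n h
  have hsec := congrArg (section6 4) hexp
  rw [section6_mul _ hW] at hsec
  simp only [map_add, map_sub,
    (hsc9.mul (hsc9.mul (hsa.mul hsa9))).section6_eq, (hsc9.mul (hsc9.mul (hsb.mul hsb9))).section6_eq,
    (hsc9.mul (hsc9.mul (hsD.mul hsD))).section6_eq, (hsc9.mul (hsc9.mul (hsc9.mul hsc9))).section6_eq,
    (hsc9.mul (hsc9.mul (hsc9.mul hsD))).section6_eq,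
    (hsc9.mul (hsc9.mul (hsb.mul hsa9))).section6_eq, (hsc9.mul (hsc9.mul (hsa.mul hsb9))).section6_eq,
    (hsc9.mul (hsD.mul (hsa.mul hsa9))).section6_eq, (hsc9.mul (hsD.mul (hsb.mul hsa9))).section6_eq,
    (hsc9.mul (hsD.mul (hsa.mul hsb9))).section6_eq, (hsc9.mul (hsD.mul (hsb.mul hsb9))).section6_eq,
    (hsD.mul (hsD.mul (hsa.mul hsa9))).section6_eq, (hsD.mul (hsD.mul (hsb.mul hsa9))).section6_eq,
    (hsD.mul (hsD.mul (hsa.mul hsb9))).section6_eq,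
    (hsD.mul (hsD.mul (hsb.mul hsb9))).section6_eq] at hsec
  simp only [show (0 + (0 + (4 + 0)) : ZMod 6) = 4 from rfl, show (0 + (0 + (1 + 3)) : ZMod 6) = 4 from rfl,
    show (0 + (0 + (2 + 2)) : ZMod 6) = 4 from rfl, if_true] at hsec
  simp only [if_neg (show (0 + (0 + (0 + 0)) : ZMod 6) ≠ 4 by decide),
    if_neg (show (0 + (0 + (0 + 2)) : ZMod 6) ≠ 4 by decide),
    if_neg (show (0 + (0 + (1 + 0)) : ZMod 6) ≠ 4 by decide),
    if_neg (show (0 + (0 + (4 + 3)) : ZMod 6) ≠ 4 by decide),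
    if_neg (show (0 + (2 + (4 + 0)) : ZMod 6) ≠ 4 by decide),
    if_neg (show (0 + (2 + (1 + 0)) : ZMod 6) ≠ 4 by decide),
    if_neg (show (0 + (2 + (4 + 3)) : ZMod 6) ≠ 4 by decide),
    if_neg (show (0 + (2 + (1 + 3)) : ZMod 6) ≠ 4 by decide),
    if_neg (show (2 + (2 + (4 + 0)) : ZMod 6) ≠ 4 by decide),
    if_neg (show (2 + (2 + (1 + 0)) : ZMod 6) ≠ 4 by decide),
    if_neg (show (2 + (2 + (4 + 3)) : ZMod 6) ≠ 4 by decide),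
    if_neg (show (2 + (2 + (1 + 3)) : ZMod 6) ≠ 4 by decide)] at hsec
  -- The constant term is 1, because c9 has constant term 1 and D has none.
  have hunit : IsUnit (c9 ^ 3 + D ^ 3) := by
    rw [PowerSeries.isUnit_iff_constantCoeff, hDdef]
    simp [hc9one, hcone]
  obtain ⟨V, hV⟩ := hunit.exists_left_inv
  refine ⟨c9 * (a' * a9 - b' * b9) * V, ?_, ?_⟩
  · have h2 : section6 4 schurSeries * (c9 ^ 3 + D ^ 3) = 3 * (c9 * (a' * a9 - b' * b9)) := by
      apply mul_right_cancel₀ hc9ne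
      linear_combination hsec + c9 ^ 2 * hD
    linear_combination V * h2 - section6 4 schurSeries * hV
  · linear_combination c9 * (a' * a9 - b' * b9) * hV

/-! ### The main congruence -/

lemma mod3_theta_nine_mul {k : ℕ} (hk : 0 < k) (w : ℤ → ℤ) :
    mod3 (theta (9 * k) w) = mod3 (theta k w) ^ 9 := by
  rw [show 9 * k = 3 * (3 * k) by ring, mod3_theta_three_mul (by omega), mod3_theta_three_mul hk,
    ← pow_mul]

lemma nine_dvd_coeff_schurSeries {k m : ℕ} (h : 4 ^ k * (2 * (2 * m + 1)) % 6 = 4) :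
    (9 : ℤ) ∣ coeff (4 ^ k * (2 * (2 * m + 1))) schurSeries := by
  obtain ⟨K, hK, hKc⟩ := exists_section6_schurSeries
  have hK3 : mod3 K = mod3 (theta 1 evenWt * theta 27 evenWt + theta 1 oddWt * theta 27 oddWt) - 1 := by
    have h9 (w : ℤ → ℤ) := mod3_theta_nine_mul one_pos w
    have h27 (w : ℤ → ℤ) := mod3_theta_nine_mul three_pos w
    have h3 (w : ℤ → ℤ) := mod3_theta_three_mul one_pos w
    have h18 := mod3_theta_nine_mul two_pos signWt
    have hc := congrArg mod3 (theta_even_sq_sub_odd_sq one_pos)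
    have h4 := mod3_theta_even_pow_four_add_odd_pow_four
    have hKc' := congrArg mod3 hKc
    norm_num at h9 h27 h3 h18 hc
    simp only [map_mul, map_add, map_sub, map_pow, h9, h27, h3, h18] at hKc' hc ⊢
    have hcne : mod3 (theta 2 signWt) ≠ 0 := by
      intro h0
      have := congrArg constantCoeff h0
      rw [← coeff_zero_eq_constantCoeff_apply, coeff_map, coeff_zero_eq_constantCoeff_apply,
        constantCoeff_theta] at this
      simp [signWt] at this
    have char3 : (3 : (ZMod 3)⟦X⟧) = 0 := by
      have : (3 : ZMod 3) = 0 := rfl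
      rw [← map_ofNat (C (R := ZMod 3)) 3, this, map_zero]
    generalize mod3 (theta 1 evenWt) = a at *
    generalize mod3 (theta 1 oddWt) = b at *
    generalize mod3 (theta 2 signWt) = c at *
    generalize mod3 K = K' at *
    -- In characteristic 3, c9³ + D³ = (c9 + D)³ = c³, and c9 becomes c⁹; the quotient is c⁶.
    have hK6 : K' = (c ^ 2) ^ 3 * ((a - a ^ 9) * a ^ 9 - (b - b ^ 9) * b ^ 9) := by
      apply mul_left_cancel₀ (pow_ne_zero 3 hcne)
      linear_combination hKc' - K' * (c * c ^ 9 * (c ^ 9 - c)) * char3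
    have h12 : a ^ 12 + b ^ 12 = 1 := by
      linear_combination ((a ^ 4 + b ^ 4) ^ 2 + (a ^ 4 + b ^ 4) + 1) * h4 -
        (a ^ 8 * b ^ 4 + a ^ 4 * b ^ 8) * char3
    have h36 : a ^ 36 + b ^ 36 = 1 := by
      linear_combination ((a ^ 12 + b ^ 12) ^ 2 + (a ^ 12 + b ^ 12) + 1) * h12 -
        (a ^ 24 * b ^ 12 + a ^ 12 * b ^ 24) * char3
    -- The terms of degrees 16, 24 and 28 are raised to the common degree 36 by factors equal to 1;
    -- `h36` does the same for the constant 1. What remains is a homogeneous polynomial identity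
    -- modulo 3.
    have e1 : (a ^ 6 - b ^ 6) * (a ^ 10 - b ^ 10) =
        (a ^ 6 - b ^ 6) * (a ^ 10 - b ^ 10) * (a ^ 12 + b ^ 12) * (a ^ 4 + b ^ 4) ^ 2 := by
      rw [h12, h4]
      ring
    have e2 : (a ^ 6 - b ^ 6) * (a ^ 18 - b ^ 18) =
        (a ^ 6 - b ^ 6) * (a ^ 18 - b ^ 18) * (a ^ 12 + b ^ 12) := by
      rw [h12]
      ring
    have e3 : a ^ 28 + b ^ 28 = (a ^ 28 + b ^ 28) * (a ^ 4 + b ^ 4) ^ 2 := by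
      rw [h4]
      ring
    rw [hK6, ← hc]
    linear_combination e1 - e2 - e3 - h36 +
      (a ^ 20 * b ^ 16 + a ^ 16 * b ^ 20 - (a ^ 14 * b ^ 10 + a ^ 10 * b ^ 14) * (a ^ 12 + b ^ 12)
        + (a ^ 2 * b ^ 4 - a ^ 4 * b ^ 2) * ((a - a ^ 9) * a ^ 9 - (b - b ^ 9) * b ^ 9)) * char3
  -- The exponent is positive, so the constant -1 in `hK3` does not contribute.
  have h0 : ((coeff (4 ^ k * (2 * (2 * m + 1))) K : ℤ) : ZMod 3) = 0 := by
    have := congrArg (coeff (4 ^ k * (2 * (2 * m + 1)))) hK3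
    rw [coeff_map, map_sub, coeff_map, coeff_theta_one_twentySeven_eq_zero, coeff_one, if_neg (by positivity)]
      at this
    simpa using this
  have h1 := congrArg (coeff (4 ^ k * (2 * (2 * m + 1)))) hK
  rw [coeff_section6, if_pos, show (3 : ℤ⟦X⟧) = C 3 by simp, coeff_C_mul] at h1
  · rw [h1]
    obtain ⟨d, hd⟩ := (ZMod.intCast_zmod_eq_zero_iff_dvd _ 3).1 h0
    rw [hd]
    exact ⟨d, by push_cast; ring⟩
  · rw [← ZMod.natCast_mod, h]
    rfl

theorem mainTheorem12 (α n : ℕ) :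
    schurOverpartitionCount 9 (3 * 4 ^ (α + 2) * n + 10 * 4 ^ (α + 1)) ≡ 0 [MOD 9] := by
  have h4 : 4 ^ (α + 1) % 6 = 4 := by
    induction α with
    | zero => rfl
    | succ α ih => rw [pow_succ, Nat.mul_mod, ih]
  -- Here 12n + 10 = 2(6n + 5) with 6n + 5 odd, so the 2-adic valuation is 2α + 3; the exponent is 4
  -- · 4 ≡ 4 mod 6.
  have h : 3 * 4 ^ (α + 2) * n + 10 * 4 ^ (α + 1) = 4 ^ (α + 1) * (2 * (2 * (3 * n + 2) + 1)) := by
    ring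
  rw [h, Nat.modEq_zero_iff_dvd]
  have := nine_dvd_coeff_schurSeries (k := α + 1) (m := 3 * n + 2) (by
    rw [Nat.mul_mod, h4]
    omega)
  rw [schurSeries, coeff_mk] at this
  exact_mod_cast this
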